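/- Consider a real discrete-time single-input single-output system $x(t+1)=Ax(t)+Bu(t)$, $y(t)=Cx(t)+Du(t)$ with nonzero transfer function $\mathsf G(z)=\mathsf N(z)/\mathsf D(z)$, where $\mathsf N,\mathsf D$ are coprime real polynomials and $\mathsf D$ is monic. The state dimension is arbitrary, but the system has the same input-output trajectories as a minimal realization of $\mathsf G$ (equivalently, every state is the sum of a reachable and an unobservable state). Let $n=\deg\mathsf D$ be the minimal order, $\nu=n-\deg\mathsf N\ge 0$ the relative degree, $\rho$ the leading coefficient of $\mathsf N$, and $l$ the lag (the observability index of a minimal realization). Let $N\ge l$ and $L\ge\nu$ be integers. Let $\mathcal W_k$ be the set of length-$k$ input-output trajectories of the system (arbitrary initial state), and let $\mathcal W_k^L$ be the set of pairs $(u,y)\in\mathbb R^k\times\mathbb R^{k+L}$ for which there is $u'\in\mathbb R^L$ such that the input $(u,u')$ together with the output $y$ is a trajectory in $\mathcal W_{k+L}$. Let $U_p,Y_p\in\mathbb R^{N\times T}$, $U_f\in\mathbb R^{1\times T}$, $Y_f^L\in\mathbb R^{(L+1)\times T}$ be data matrices such that each column of $\begin{bmatrix}U_p\\U_f\\Y_p\\Y_f^L\end{bmatrix}$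 belongs to $\mathcal W_{N+1}^L$ (the input is the column of $\begin{bmatrix}U_p\\U_f\end{bmatrix}$ and the output is that of $\begin{bmatrix}Y_p\\Y_f^L\end{bmatrix}$). Put $H_{\rm inv}=\begin{bmatrix}U_p\\Y_p\\Y_f^L\end{bmatrix}$ and assume $\operatorname{rank}(H_{\rm inv})=N+n+L-\nu+1$. With the Moore-Penrose inverse $H_{\rm inv}^\dagger$, write $$U_fH_{\rm inv}^\dagger=[c_0,\dots,c_{N-1},d_0,\dots,d_{N+L}],\qquad \mathsf N_{\rm inv}^\star(z)=z^N-\sum_{k=0}^{N-1}c_kz^k,\qquad \mathsf D_{\rm inv}^\star(z)=\sum_{k=0}^{N+L}d_kz^k .$$ Then there exists a monic polynomial $\mathsf C_{\rm inv}^\star(z)$ of degree $N-n+\nu$, Schur stable (all its complex roots lie in $|z|<1$), such that $$\mathsf N_{\rm inv}^\star(z)=\frac1\rho\,\mathsf C_{\rm inv}^\star(z)\mathsf N(z),\qquad \mathsf D_{\rm inv}^\star(z)=\frac1\rho\,\mathsf C_{\rm inv}^\star(z)\mathsf D(z).$$ Furthermore, $\mathsf C_{\rm inv}^\star(z)$ is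 determined solely by $\mathsf G(z)$ and $N$: it does not depend on $L$, on the data, or on the state-space representation. -/

import Mathlib

open Polynomial Matrix

noncomputable section

namespace DDInv

/-! ### Moore-Penrose inverse of a real matrix -/

/-- The four Penrose equations: `X` is a Moore-Penrose inverse of the real matrix `A`. -/
structure IsMoorePenrose {m n : Type*} [Fintype m] [Fintype n]
    (A : Matrix m n ℝ) (X : Matrix n m ℝ) : Prop where
  mul_mul_left : A * X * A = A
  mul_mul_right : X * A * X = X
  symm_left : (A * X)ᵀ = A * X
  symm_right : (X * A)ᵀ = X * A

/-- Moore-Penrose inverse of a symmetric matrix: invert the nonzero eigenvalues in an orthonormal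
eigenbasis (the zero eigenvalues are kept, since `0⁻¹ = 0`). -/
def symmPinv {n : Type*} [Fintype n] [DecidableEq n] {S : Matrix n n ℝ} (hS : S.IsHermitian) :
    Matrix n n ℝ :=
  (hS.eigenvectorUnitary : Matrix n n ℝ) * diagonal (fun i => (hS.eigenvalues i)⁻¹) *
    (hS.eigenvectorUnitary : Matrix n n ℝ)ᵀ

/-- The Moore-Penrose inverse `A† = (Aᵀ A)† Aᵀ` of a real matrix. -/
def pinv {m n : Type*} [Fintype m] [Fintype n] [DecidableEq n] (A : Matrix m n ℝ) :
    Matrix n m ℝ :=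
  symmPinv (S := Aᵀ * A) (isHermitian_conjTranspose_mul_self A) * Aᵀ

theorem isMoorePenrose_unique {m n : Type*} [Fintype m] [Fintype n]
    {A : Matrix m n ℝ} {X Y : Matrix n m ℝ} (hX : IsMoorePenrose A X) (hY : IsMoorePenrose A Y) :
    X = Y := by
  have h1 : A * X = A * Y := by
    calc A * X = (A * X)ᵀ := hX.symm_left.symm
      _ = ((A * Y) * (A * X))ᵀ := by rw [← Matrix.mul_assoc, hY.mul_mul_left]
      _ = (A * X)ᵀ * (A * Y)ᵀ := by rw [transpose_mul]
      _ = (A * X) * (A * Y) := by rw [hX.symm_left, hY.symm_left]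
      _ = A * Y := by rw [← Matrix.mul_assoc, hX.mul_mul_left]
  have h2 : X * A = Y * A := by
    calc X * A = (X * A)ᵀ := hX.symm_right.symm
      _ = ((X * A) * (Y * A))ᵀ := by
          rw [Matrix.mul_assoc X A, ← Matrix.mul_assoc A Y A, hY.mul_mul_left]
      _ = (Y * A)ᵀ * (X * A)ᵀ := by rw [transpose_mul]
      _ = (Y * A) * (X * A) := by rw [hX.symm_right, hY.symm_right]
      _ = Y * A := by rw [Matrix.mul_assoc Y A, ← Matrix.mul_assoc A X A, hX.mul_mul_left]
  calc X = X * A * X := hX.mul_mul_right.symm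
    _ = Y * A * Y := by rw [h2, Matrix.mul_assoc, h1, ← Matrix.mul_assoc]
    _ = Y := hY.mul_mul_right

theorem symmPinv_spec {n : Type*} [Fintype n] [DecidableEq n] {S : Matrix n n ℝ}
    (hS : S.IsHermitian) :
    S * symmPinv hS * S = S ∧ symmPinv hS * S * symmPinv hS = symmPinv hS ∧
      S * symmPinv hS = symmPinv hS * S ∧ (symmPinv hS)ᵀ = symmPinv hS := by
  have hU : (hS.eigenvectorUnitary : Matrix n n ℝ)ᵀ * (hS.eigenvectorUnitary : Matrix n n ℝ) = 1 :=
    Unitary.coe_star_mul_self hS.eigenvectorUnitary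
  have hspec : S = (hS.eigenvectorUnitary : Matrix n n ℝ) * diagonal hS.eigenvalues *
      (hS.eigenvectorUnitary : Matrix n n ℝ)ᵀ := by
    conv_lhs => rw [hS.spectral_theorem, Unitary.conjStarAlgAut_apply]
    rfl
  have hmul : ∀ d e : n → ℝ,
      ((hS.eigenvectorUnitary : Matrix n n ℝ) * diagonal d *
        (hS.eigenvectorUnitary : Matrix n n ℝ)ᵀ) *
      ((hS.eigenvectorUnitary : Matrix n n ℝ) * diagonal e *
        (hS.eigenvectorUnitary : Matrix n n ℝ)ᵀ) =
      (hS.eigenvectorUnitary : Matrix n n ℝ) * diagonal (fun i => d i * e i) *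
        (hS.eigenvectorUnitary : Matrix n n ℝ)ᵀ := by
    intro d e
    rw [← diagonal_mul_diagonal]
    simp only [Matrix.mul_assoc]
    rw [← Matrix.mul_assoc _ᵀ (hS.eigenvectorUnitary : Matrix n n ℝ), hU, Matrix.one_mul]
  have key : ∀ {P : Matrix n n ℝ}, P = S → P * symmPinv hS * P = P ∧
      symmPinv hS * P * symmPinv hS = symmPinv hS ∧ P * symmPinv hS = symmPinv hS * P := by
    intro P hP
    rw [hP.trans hspec]
    unfold symmPinv
    simp only [hmul]
    refine ⟨?_, ?_, ?_⟩
    · congr 3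
      funext i
      exact mul_inv_mul_cancel _
    · congr 3
      funext i
      by_cases h : hS.eigenvalues i = 0 <;> simp [h]
    · simp only [mul_comm]
  obtain ⟨h1, h2, h3⟩ := key rfl
  refine ⟨h1, h2, h3, ?_⟩
  unfold symmPinv
  simp [transpose_mul, Matrix.mul_assoc]

/-- `pinv A` is the Moore-Penrose inverse of `A`. -/
theorem isMoorePenrose_pinv {m n : Type*} [Fintype m] [Fintype n] [DecidableEq n]
    (A : Matrix m n ℝ) : IsMoorePenrose A (pinv A) := by
  obtain ⟨h1, h2, h3, h4⟩ := symmPinv_spec (S := Aᵀ * A) (isHermitian_conjTranspose_mul_self A)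
  unfold pinv
  generalize symmPinv (S := Aᵀ * A) (isHermitian_conjTranspose_mul_self A) = G at *
  have hz : A * (G * (Aᵀ * A) - 1) = 0 := by
    rw [← conjTranspose_mul_self_eq_zero, conjTranspose_mul, Matrix.mul_assoc]
    have : Aᴴ * (A * (G * (Aᵀ * A) - 1)) = 0 := by
      rw [conjTranspose_eq_transpose_of_trivial, ← Matrix.mul_assoc, Matrix.mul_sub, ← Matrix.mul_assoc, h1, Matrix.mul_one, sub_self]
    rw [this, Matrix.mul_zero]
  refine ⟨?_, ?_, ?_, ?_⟩
  · rw [Matrix.mul_sub, Matrix.mul_one, sub_eq_zero] at hz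
    rw [Matrix.mul_assoc, Matrix.mul_assoc G]
    exact hz
  · calc G * Aᵀ * A * (G * Aᵀ) = (G * (Aᵀ * A) * G) * Aᵀ := by simp only [Matrix.mul_assoc]
      _ = G * Aᵀ := by rw [h2]
  · simp only [transpose_mul, transpose_transpose, h4, Matrix.mul_assoc]
  · rw [Matrix.mul_assoc, transpose_mul, h4, transpose_mul, transpose_transpose, h3]

/-! ### Discrete-time single-input single-output state-space systems -/

/-- A real discrete-time SISO state-space system of state dimension `k`:
`x(t+1) = A x(t) + b u(t)`, `y(t) = c x(t) + d u(t)`. -/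
structure SISO (k : ℕ) where
  A : Matrix (Fin k) (Fin k) ℝ
  b : Fin k → ℝ
  c : Fin k → ℝ
  d : ℝ

namespace SISO

variable {k : ℕ}

/-- The transfer function `c (z I - A)⁻¹ b + d`, a real rational function of `z`. -/
def transfer (S : SISO k) : RatFunc ℝ :=
  (fun i => RatFunc.C (S.c i)) ⬝ᵥ
      (((RatFunc.X : RatFunc ℝ) • (1 : Matrix (Fin k) (Fin k) (RatFunc ℝ))
        - S.A.map RatFunc.C)⁻¹ *ᵥ fun i => RatFunc.C (S.b i))
    + RatFunc.C S.d

/-- The reachable (controllable) subspace, spanned by `b, A b, A² b, …`. -/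
def reachable (S : SISO k) : Submodule ℝ (Fin k → ℝ) :=
  Submodule.span ℝ (Set.range fun i : ℕ => (S.A ^ i) *ᵥ S.b)

/-- States which produce zero output during the first `j` steps under zero input, i.e. the kernel
of the observability matrix with rows `c, c A, …, c A^(j-1)`. -/
def unobservableUpTo (S : SISO k) (j : ℕ) : Submodule ℝ (Fin k → ℝ) where
  carrier := {x | ∀ i < j, S.c ⬝ᵥ ((S.A ^ i) *ᵥ x) = 0}
  add_mem' := by
    intro x y hx hy i hi
    rw [mulVec_add, dotProduct_add, hx i hi, hy i hi, add_zero]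
  zero_mem' := by
    intro i _
    rw [mulVec_zero, dotProduct_zero]
  smul_mem' := by
    intro r x hx i hi
    rw [mulVec_smul, dotProduct_smul, hx i hi, smul_zero]

/-- The unobservable subspace. -/
def unobservable (S : SISO k) : Submodule ℝ (Fin k → ℝ) := ⨅ j, S.unobservableUpTo j

/-- The observable part of the system (its dynamics modulo the unobservable subspace) is reachable.
Equivalently, `S` has the same input-output trajectories as a minimal realization of its transfer
function. Every reachable system, in particular every minimal one, satisfies this. -/
def ObservablePartReachable (S : SISO k) : Prop := S.reachable ⊔ S.unobservable = ⊤

theorem unobservableUpTo_dim (S : SISO k) : S.unobservableUpTo k = S.unobservable := by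
  refine le_antisymm (le_iInf fun j x hx i _ => ?_) (iInf_le _ _)
  have hdeg : (X ^ i %ₘ S.A.charpoly).degree < (k : WithBot ℕ) := by
    have := degree_modByMonic_lt (X ^ i) S.A.charpoly_monic
    rwa [charpoly_degree_eq_dim, Fintype.card_fin] at this
  rw [pow_eq_aeval_mod_charpoly]
  generalize X ^ i %ₘ S.A.charpoly = p at *
  rw [aeval_eq_sum_range, sum_mulVec, dotProduct_sum]
  refine Finset.sum_eq_zero fun e _ => ?_
  rw [smul_mulVec, dotProduct_smul]
  by_cases he : e < k
  · rw [hx e he, smul_zero]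
  · have : p.coeff e = 0 := coeff_eq_zero_of_degree_lt
      (hdeg.trans_le (by exact_mod_cast not_lt.mp he))
    rw [this, zero_smul]

theorem exists_lag (S : SISO k) : ∃ j, S.unobservableUpTo j = S.unobservable :=
  ⟨k, S.unobservableUpTo_dim⟩

open Classical in
/-- The lag: the least `j` at which the kernel of the observability matrix with `j` rows has become
the unobservable subspace. This is the observability index of the observable part. -/
def lag (S : SISO k) : ℕ := Nat.find S.exists_lag

/-- `(u, y) ∈ 𝒲_q`: the pair `(u, y)` is a length-`q` input-output trajectory of the system, with
an arbitrary initial state. -/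
def IsTraj (S : SISO k) {q : ℕ} (u y : Fin q → ℝ) : Prop :=
  ∃ x : ℕ → (Fin k → ℝ), ∀ t : Fin q,
    x (t + 1) = S.A *ᵥ x t + u t • S.b ∧ y t = S.c ⬝ᵥ x t + S.d * u t

/-- `(u, y) ∈ 𝒲_q^L`: the input `u` of length `q` can be prolonged by `L` further samples `u'` so
that `((u, u'), y)` is a trajectory of length `q + L`. -/
def IsTrajExt (S : SISO k) {q : ℕ} (L : ℕ) (u : Fin q → ℝ) (y : Fin (q + L) → ℝ) : Prop :=
  ∃ u' : Fin L → ℝ, S.IsTraj (Fin.append u u') y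

end SISO

/-- The order of a rational function `G = N/D` in lowest terms with `D` monic: `n = deg D`. -/
def order (G : RatFunc ℝ) : ℕ := G.denom.natDegree

/-- The relative degree `ν = deg D - deg N` of a proper rational function `G = N/D`. -/
def relDegree (G : RatFunc ℝ) : ℕ := G.denom.natDegree - G.num.natDegree

/-- All complex roots lie in the open unit disc. -/
def IsSchur (p : ℝ[X]) : Prop := ∀ z : ℂ, aeval z p = 0 → ‖z‖ < 1

/-! ### Data matrices and the data-driven inverse -/

variable {N L T : ℕ}

/-- Every column of the matrix with the row blocks `U_p` (`N` rows), `U_f` (one row), `Y_p`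
(`N` rows), `Y_f` (`L + 1` rows) belongs to `𝒲_{N+1}^L`. -/
def IsData {k : ℕ} (S : SISO k) (Up : Matrix (Fin N) (Fin T) ℝ) (Uf : Fin T → ℝ)
    (Yp : Matrix (Fin N) (Fin T) ℝ) (Yf : Matrix (Fin (L + 1)) (Fin T) ℝ) : Prop :=
  ∀ j : Fin T, S.IsTrajExt (q := N + 1) L
    (Fin.snoc (fun i => Up i j) (Uf j) : Fin (N + 1) → ℝ)
    (fun i : Fin (N + 1 + L) =>
      Fin.append (fun i => Yp i j) (fun i => Yf i j)
        (Fin.cast (show N + 1 + L = N + (L + 1) by omega) i))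

/-- The matrix with the row blocks `U_p`, `Y_p`, `Y_f`. -/
def Hinv (Up : Matrix (Fin N) (Fin T) ℝ) (Yp : Matrix (Fin N) (Fin T) ℝ)
    (Yf : Matrix (Fin (L + 1)) (Fin T) ℝ) :
    Matrix (Fin N ⊕ (Fin N ⊕ Fin (L + 1))) (Fin T) ℝ :=
  fromRows Up (fromRows Yp Yf)

/-- The row vector `U_f H†`, with entries `c_0, …, c_{N-1}` (index `inl k`), then
`d_0, …, d_{N-1}` (index `inr (inl k)`), then `d_N, …, d_{N+L}` (index `inr (inr k)`). -/
def coeffs (Up : Matrix (Fin N) (Fin T) ℝ) (Uf : Fin T → ℝ) (Yp : Matrix (Fin N) (Fin T) ℝ)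
    (Yf : Matrix (Fin (L + 1)) (Fin T) ℝ) : Fin N ⊕ (Fin N ⊕ Fin (L + 1)) → ℝ :=
  Uf ᵥ* pinv (Hinv Up Yp Yf)

/-- `z^N - ∑_{k < N} c_k z^k`. -/
def Ninv (Up : Matrix (Fin N) (Fin T) ℝ) (Uf : Fin T → ℝ) (Yp : Matrix (Fin N) (Fin T) ℝ)
    (Yf : Matrix (Fin (L + 1)) (Fin T) ℝ) : ℝ[X] :=
  X ^ N - ∑ k : Fin N, C (coeffs Up Uf Yp Yf (Sum.inl k)) * X ^ (k : ℕ)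

/-- `∑_{k ≤ N + L} d_k z^k`. -/
def Dinv (Up : Matrix (Fin N) (Fin T) ℝ) (Uf : Fin T → ℝ) (Yp : Matrix (Fin N) (Fin T) ℝ)
    (Yf : Matrix (Fin (L + 1)) (Fin T) ℝ) : ℝ[X] :=
  ∑ k : Fin N, C (coeffs Up Uf Yp Yf (Sum.inr (Sum.inl k))) * X ^ (k : ℕ) +
    ∑ k : Fin (L + 1), C (coeffs Up Uf Yp Yf (Sum.inr (Sum.inr k))) * X ^ (N + (k : ℕ))

end DDInv

end

/-! Write G = a/b in lowest terms, n = deg b, ν = n - deg a, m = N + ν - n. For every polynomial h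
the product (h b) G = h a is a polynomial, which forces ∑ (h b)_t y_t = ∑ (h a)_t u_t along every
trajectory (`sum_output_eq_sum_input`; reachability of the observable part enters here). If deg h <
m, this relation does not involve u_N and gives a left kernel vector of H_inv; the rank hypothesis
leaves exactly m dimensions, so there are no others. If h = p/ρ with p monic of degree m, then u_N
has coefficient 1 and the relation solves w H_inv = U_f; every solution has this form.

The vector U_f H_inv† is the solution orthogonal to the left kernel. Hence p is the monic polynomial
of degree m orthogonal to all lower degrees for the inner product ⟨p a, q a⟩ + ⟨p b, q b⟩ of
coefficient sequences (`exists_isMonicOrthogonal`), so G and N alone determine it. Multiplication by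
z is an isometry for this inner product, and this puts the roots of p in the open disc, as for Szegő
polynomials (`IsMonicOrthogonal.isSchur`). -/

noncomputable section

namespace DDInv

/-! ### The transfer function and the trajectories -/

namespace SISO

variable {k : ℕ} (S : SISO k)

/-- The rational function `c (z I - A)⁻¹ v`. -/
def resolv : (Fin k → ℝ) →ₗ[ℝ] RatFunc ℝ where
  toFun v := (fun i => RatFunc.C (S.c i)) ⬝ᵥ
      (((RatFunc.X : RatFunc ℝ) • (1 : Matrix (Fin k) (Fin k) (RatFunc ℝ))
        - S.A.map RatFunc.C)⁻¹ *ᵥ fun i => RatFunc.C (v i))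
  map_add' v w := by
    rw [← dotProduct_add, ← mulVec_add]
    congr 2
    funext i
    simp
  map_smul' r v := by
    rw [RingHom.id_apply, RatFunc.smul_eq_C_mul, ← smul_eq_mul, ← dotProduct_smul, ← mulVec_smul]
    congr 2
    funext i
    simp

theorem transfer_eq : S.transfer = S.resolv S.b + RatFunc.C S.d := rfl

theorem isUnit_det_resolvent :
    IsUnit ((RatFunc.X : RatFunc ℝ) • (1 : Matrix (Fin k) (Fin k) (RatFunc ℝ))
        - S.A.map RatFunc.C).det := by
  have h : (RatFunc.X : RatFunc ℝ) • (1 : Matrix (Fin k) (Fin k) (RatFunc ℝ))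
        - S.A.map RatFunc.C = (algebraMap ℝ[X] (RatFunc ℝ)).mapMatrix (charmatrix S.A) := by
    ext i j
    by_cases hij : i = j <;> simp [hij, RatFunc.algebraMap_X]
  rw [h, ← RingHom.map_det, isUnit_iff_ne_zero]
  exact (map_ne_zero_iff _ (RatFunc.algebraMap_injective ℝ)).mpr S.A.charpoly_monic.ne_zero

theorem X_mul_resolv (v : Fin k → ℝ) :
    RatFunc.X * S.resolv v = S.resolv (S.A *ᵥ v) + RatFunc.C (S.c ⬝ᵥ v) := by
  have h := nonsing_inv_mul _ S.isUnit_det_resolvent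
  have hA : (fun i => RatFunc.C ((S.A *ᵥ v) i)) =
      S.A.map RatFunc.C *ᵥ fun i => RatFunc.C (v i) := by
    funext i
    simp [mulVec, dotProduct]
  have hc : RatFunc.C (S.c ⬝ᵥ v) = (fun i => RatFunc.C (S.c i)) ⬝ᵥ fun i => RatFunc.C (v i) := by
    simp [dotProduct]
  simp only [resolv, LinearMap.coe_mk, AddHom.coe_mk]
  rw [hA, hc]
  generalize (fun i => RatFunc.C (v i)) = V at *
  generalize S.A.map RatFunc.C = M at *
  have h2 := congrArg (fun Z => Z *ᵥ V) h
  simp only [← mulVec_mulVec, sub_mulVec, smul_mulVec, one_mulVec, mulVec_sub, mulVec_smul] at h2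
  rw [← smul_eq_mul, ← dotProduct_smul, sub_eq_iff_eq_add.mp h2, dotProduct_add, add_comm]

/-- The polynomial part of `z ^ j * c (z I - A)⁻¹ v`. -/
def powQuot (v : Fin k → ℝ) (j : ℕ) : ℝ[X] :=
  ∑ i ∈ Finset.range j, monomial i (S.c ⬝ᵥ ((S.A ^ (j - 1 - i)) *ᵥ v))

/-- The polynomial part of `p * c (z I - A)⁻¹ v`. -/
def quot (v : Fin k → ℝ) : ℝ[X] →ₗ[ℝ] ℝ[X] :=
  (basisMonomials ℝ).constr ℝ (S.powQuot v)

theorem quot_monomial (v : Fin k → ℝ) (j : ℕ) : S.quot v (monomial j 1) = S.powQuot v j := by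
  have := (basisMonomials ℝ).constr_basis ℝ (S.powQuot v) j
  rwa [coe_basisMonomials] at this

theorem powQuot_succ (v : Fin k → ℝ) (j : ℕ) :
    S.powQuot v (j + 1) = X * S.powQuot v j + C (S.c ⬝ᵥ ((S.A ^ j) *ᵥ v)) := by
  unfold powQuot
  rw [Finset.sum_range_succ', Finset.mul_sum]
  congr 1
  refine Finset.sum_congr rfl fun i hi => ?_
  rw [X_mul_monomial, show j + 1 - 1 - (i + 1) = j - 1 - i by omega]

theorem X_pow_mul_resolv (v : Fin k → ℝ) (j : ℕ) :
    RatFunc.X ^ j * S.resolv v =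
      S.resolv ((S.A ^ j) *ᵥ v) + algebraMap ℝ[X] (RatFunc ℝ) (S.powQuot v j) := by
  induction j with
  | zero => simp [powQuot]
  | succ j ih =>
    rw [pow_succ', mul_assoc, ih, mul_add, X_mul_resolv, powQuot_succ, map_add, map_mul,
      RatFunc.algebraMap_X, RatFunc.algebraMap_C, mulVec_mulVec, ← pow_succ']
    ring

/-- Splits the product into a strictly proper part and a polynomial part; the case of monomials
extends linearly. -/
theorem algebraMap_mul_resolv (v : Fin k → ℝ) (p : ℝ[X]) :
    algebraMap ℝ[X] (RatFunc ℝ) p * S.resolv v =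
      S.resolv (aeval S.A p *ᵥ v) + algebraMap ℝ[X] (RatFunc ℝ) (S.quot v p) := by
  induction p using Polynomial.induction_on' with
  | add p q hp hq => simp only [map_add, add_mul, hp, hq, add_mulVec]; ring
  | monomial j r =>
    have h1 : monomial j r = r • monomial j (1 : ℝ) := by simp [smul_monomial]
    have h2 := S.X_pow_mul_resolv v j
    rw [h1, map_smul (aeval S.A), (S.quot v).map_smul, quot_monomial, smul_mulVec,
      (S.resolv).map_smul, smul_eq_C_mul, smul_eq_C_mul, map_mul, map_mul, ← X_pow_eq_monomial,
      map_pow, RatFunc.algebraMap_X, RatFunc.algebraMap_C, mul_assoc, h2, RatFunc.smul_eq_C_mul,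
      mul_add, map_pow, aeval_X]

theorem quot_degree_lt (v : Fin k → ℝ) {p : ℝ[X]} {m : ℕ} (hp : p.natDegree ≤ m) :
    (S.quot v p).degree < m := by
  rw [← mem_degreeLT, p.as_sum_range' (m + 1) (by omega), map_sum]
  refine Submodule.sum_mem _ fun j hj => ?_
  rw [← mul_one (p.coeff j), ← smul_eq_mul, ← smul_monomial, map_smul, quot_monomial]
  refine Submodule.smul_mem _ _ (Submodule.sum_mem _ fun i hi => ?_)
  rw [mem_degreeLT]
  refine (degree_monomial_le _ _).trans_lt ?_
  simp only [Finset.mem_range] at hi hj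
  exact_mod_cast (by omega : i < m)

/-- Strict properness: by Cayley-Hamilton, multiplying by the characteristic polynomial leaves a
polynomial of degree less than k, too small for a nonzero multiple of a polynomial of degree k. -/
theorem resolv_eq_zero_of_eq_algebraMap {v : Fin k → ℝ} {p : ℝ[X]}
    (h : S.resolv v = algebraMap ℝ[X] (RatFunc ℝ) p) : S.resolv v = 0 := by
  have h1 := S.algebraMap_mul_resolv v S.A.charpoly
  have hd : S.A.charpoly.natDegree = k := by simp
  rw [aeval_self_charpoly, zero_mulVec, map_zero, zero_add, h, ← map_mul] at h1
  have h2 := RatFunc.algebraMap_injective ℝ h1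
  have h3 := S.quot_degree_lt v hd.le
  rw [← h2] at h3
  by_cases hp : p = 0
  · rw [h, hp, map_zero]
  · rw [degree_mul, degree_eq_natDegree hp, degree_eq_natDegree S.A.charpoly_monic.ne_zero, hd] at h3
    norm_cast at h3
    omega

theorem dotProduct_pow_mulVec_eq_zero {v : Fin k → ℝ} (h : S.resolv v = 0) (j : ℕ) :
    S.c ⬝ᵥ ((S.A ^ j) *ᵥ v) = 0 := by
  have h1 := S.X_pow_mul_resolv v (j + 1)
  rw [h, mul_zero, eq_comm, add_eq_zero_iff_eq_neg, ← map_neg] at h1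
  have h2 := S.X_pow_mul_resolv v (j + 1)
  -- The polynomial part of z^(j+1) · 0 vanishes; its constant coefficient is c A^j v.
  rw [S.resolv_eq_zero_of_eq_algebraMap h1, h, mul_zero, zero_add, eq_comm,
    map_eq_zero_iff _ (RatFunc.algebraMap_injective ℝ), powQuot_succ] at h2
  simpa using congrArg (coeff · 0) h2

/-- Makes the truncated subtraction in `relDegree` a true one. -/
theorem transfer_proper : S.transfer.num.natDegree ≤ S.transfer.denom.natDegree := by
  by_cases h0 : S.transfer = 0
  · simp [h0]
  have hd : S.A.charpoly.natDegree = k := by simp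
  have h1 := S.algebraMap_mul_resolv S.b S.A.charpoly
  rw [aeval_self_charpoly, zero_mulVec, map_zero, zero_add] at h1
  have h2 : algebraMap ℝ[X] (RatFunc ℝ) S.A.charpoly * S.transfer =
      algebraMap ℝ[X] (RatFunc ℝ) (S.quot S.b S.A.charpoly + C S.d * S.A.charpoly) := by
    rw [transfer_eq, mul_add, h1, map_add, map_mul, RatFunc.algebraMap_C]
    ring
  set P := S.quot S.b S.A.charpoly + C S.d * S.A.charpoly with hP
  have hPd : P.natDegree ≤ k := by
    refine (natDegree_add_le _ _).trans (max_le ?_ ?_)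
    · exact natDegree_le_of_degree_le (S.quot_degree_lt S.b hd.le).le
    · exact (natDegree_C_mul_le _ _).trans hd.le
  have hden : algebraMap ℝ[X] (RatFunc ℝ) S.transfer.denom ≠ 0 :=
    (map_ne_zero_iff _ (RatFunc.algebraMap_injective ℝ)).mpr S.transfer.denom_ne_zero
  have h3 : S.A.charpoly * S.transfer.num = P * S.transfer.denom := by
    apply RatFunc.algebraMap_injective ℝ
    rw [map_mul, map_mul, ← h2, mul_assoc]
    congr 1
    rw [← div_eq_iff hden, RatFunc.num_div_denom]
  have hnum : S.transfer.num ≠ 0 := RatFunc.num_ne_zero h0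
  have h4 := congrArg natDegree h3
  rw [natDegree_mul S.A.charpoly_monic.ne_zero hnum, hd] at h4
  have := natDegree_mul_le (p := P) (q := S.transfer.denom)
  omega

/-- If `p * G` is a polynomial `a`, then `p` annihilates the state part of the output, and `a` is
the polynomial part of `p * (c (z I - A)⁻¹ b + d)`. -/
theorem quot_eq_of_mul_transfer {p a : ℝ[X]}
    (h : algebraMap ℝ[X] (RatFunc ℝ) p * S.transfer = algebraMap ℝ[X] (RatFunc ℝ) a) :
    S.resolv (aeval S.A p *ᵥ S.b) = 0 ∧ S.quot S.b p + C S.d * p = a := by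
  rw [transfer_eq, mul_add, algebraMap_mul_resolv, ← RatFunc.algebraMap_C, ← map_mul, add_assoc,
    ← map_add] at h
  have h1 : S.resolv (aeval S.A p *ᵥ S.b) = 0 := by
    refine S.resolv_eq_zero_of_eq_algebraMap (p := a - (S.quot S.b p + p * C S.d)) ?_
    rw [map_sub, ← h]
    ring
  refine ⟨h1, ?_⟩
  rw [h1, zero_add] at h
  rw [mul_comm (C S.d)]
  exact RatFunc.algebraMap_injective ℝ h

/-- On reachable states p(A) commutes with A^i, and p(A) b is unobservable; on unobservable states
each c A^j x is already zero. -/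
theorem dotProduct_aeval_mulVec_eq_zero (hS : S.ObservablePartReachable) {p : ℝ[X]}
    (h : S.resolv (aeval S.A p *ᵥ S.b) = 0) (x : Fin k → ℝ) :
    S.c ⬝ᵥ (aeval S.A p *ᵥ x) = 0 := by
  let f : (Fin k → ℝ) →ₗ[ℝ] ℝ := (dotProductBilin ℝ ℝ S.c).comp (aeval S.A p).mulVecLin
  suffices hf : (⊤ : Submodule ℝ (Fin k → ℝ)) ≤ LinearMap.ker f by
    exact hf (Submodule.mem_top (x := x))
  rw [← hS]
  refine sup_le (Submodule.span_le.mpr ?_) fun x hx => ?_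
  · rintro _ ⟨i, rfl⟩
    change S.c ⬝ᵥ (aeval S.A p *ᵥ ((S.A ^ i) *ᵥ S.b)) = 0
    have hcomm : aeval S.A p * S.A ^ i = S.A ^ i * aeval S.A p := by
      conv_lhs => rw [← aeval_X (R := ℝ) S.A, ← map_pow, aeval_X, ← map_mul, mul_comm, map_mul]
      rw [map_pow, aeval_X]
    rw [mulVec_mulVec, hcomm, ← mulVec_mulVec]
    exact S.dotProduct_pow_mulVec_eq_zero h i
  · change S.c ⬝ᵥ (aeval S.A p *ᵥ x) = 0
    rw [aeval_eq_sum_range, sum_mulVec, dotProduct_sum]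
    refine Finset.sum_eq_zero fun j _ => ?_
    rw [smul_mulVec, dotProduct_smul, (Submodule.mem_iInf _).mp hx (j + 1) j (by omega),
      smul_zero]

theorem state_eq {x : ℕ → Fin k → ℝ} {u : ℕ → ℝ} {q : ℕ}
    (hx : ∀ t < q, x (t + 1) = S.A *ᵥ x t + u t • S.b) {t : ℕ} (ht : t ≤ q) :
    x t = (S.A ^ t) *ᵥ x 0 + ∑ i ∈ Finset.range t, u i • ((S.A ^ (t - 1 - i)) *ᵥ S.b) := by
  induction t with
  | zero => simp
  | succ t ih =>
    rw [hx t (by omega), ih (by omega), mulVec_add, mulVec_mulVec, ← pow_succ',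
      Finset.sum_range_succ, add_assoc, mulVec_sum]
    congr 2
    · refine Finset.sum_congr rfl fun i hi => ?_
      rw [Finset.mem_range] at hi
      rw [mulVec_smul, mulVec_mulVec, ← pow_succ', show t + 1 - 1 - i = t - 1 - i + 1 by omega]
    · simp

/-- If `p * G` is a polynomial `a`, then `∑ p_t y_t = ∑ a_t u_t` along all trajectories. -/
theorem sum_output_eq_sum_input (hS : S.ObservablePartReachable) {p a : ℝ[X]}
    (h : algebraMap ℝ[X] (RatFunc ℝ) p * S.transfer = algebraMap ℝ[X] (RatFunc ℝ) a)
    {x : ℕ → Fin k → ℝ} {u y : ℕ → ℝ} {q r : ℕ}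
    (hx : ∀ t < q, x (t + 1) = S.A *ᵥ x t + u t • S.b)
    (hy : ∀ t < q, y t = S.c ⬝ᵥ x t + S.d * u t)
    (hp : p.natDegree < q) (ha : a.natDegree < r) :
    ∑ t ∈ Finset.range q, p.coeff t * y t = ∑ t ∈ Finset.range r, a.coeff t * u t := by
  obtain ⟨h1, h2⟩ := S.quot_eq_of_mul_transfer h
  -- `F` substitutes u_t for z^t. It turns the polynomial part of z^t c (zI - A)⁻¹ b into the forced
  -- response at time t, and the identity `h2` into the input side of the relation.
  let F : ℝ[X] →ₗ[ℝ] ℝ := (basisMonomials ℝ).constr ℝ u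
  have hF1 : ∀ j r, F (monomial j r) = r * u j := by
    intro j r
    have := (basisMonomials ℝ).constr_basis ℝ u j
    rw [coe_basisMonomials] at this
    rw [← mul_one r, ← smul_eq_mul, ← smul_monomial, map_smul, this, smul_eq_mul, smul_eq_mul,
      mul_one]
  have hF : ∀ (f : ℝ[X]) (m : ℕ), f.natDegree < m →
      F f = ∑ t ∈ Finset.range m, f.coeff t * u t := by
    intro f m hm
    conv_lhs => rw [f.as_sum_range' m hm]
    rw [map_sum]
    exact Finset.sum_congr rfl fun t _ => hF1 _ _
  have hyt : ∀ t < q, y t = S.c ⬝ᵥ ((S.A ^ t) *ᵥ x 0) + F (S.powQuot S.b t) + S.d * u t := by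
    intro t ht
    rw [hy t ht, S.state_eq hx ht.le, dotProduct_add, dotProduct_sum, powQuot, map_sum]
    congr 2
    refine Finset.sum_congr rfl fun i _ => ?_
    rw [hF1, dotProduct_smul, smul_eq_mul, mul_comm]
  have h3 : ∑ t ∈ Finset.range q, p.coeff t * (S.c ⬝ᵥ ((S.A ^ t) *ᵥ x 0)) = 0 := by
    rw [← S.dotProduct_aeval_mulVec_eq_zero hS h1 (x 0), aeval_eq_sum_range' hp, sum_mulVec,
      dotProduct_sum]
    refine Finset.sum_congr rfl fun t _ => ?_
    rw [smul_mulVec, dotProduct_smul, smul_eq_mul]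
  have h4 : ∑ t ∈ Finset.range q, p.coeff t * F (S.powQuot S.b t) = F (S.quot S.b p) := by
    conv_rhs => rw [p.as_sum_range' q hp]
    rw [map_sum, map_sum]
    refine Finset.sum_congr rfl fun t _ => ?_
    rw [← S.quot_monomial, ← smul_eq_mul, ← map_smul, ← map_smul, smul_monomial, smul_eq_mul,
      mul_one]
  have h5 : ∀ t ∈ Finset.range q, p.coeff t * y t = p.coeff t * (S.c ⬝ᵥ ((S.A ^ t) *ᵥ x 0)) +
      p.coeff t * F (S.powQuot S.b t) + S.d * (p.coeff t * u t) := by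
    intro t ht
    rw [hyt t (Finset.mem_range.mp ht)]
    ring
  rw [Finset.sum_congr rfl h5, Finset.sum_add_distrib, Finset.sum_add_distrib, h3, h4, zero_add,
    ← Finset.mul_sum, ← hF p q hp, ← hF a r ha, ← h2, map_add, ← smul_eq_C_mul, map_smul,
    smul_eq_mul]

end SISO

/-! ### Monic orthogonal polynomials for the coefficient inner product -/

/-- The Euclidean inner product of the coefficient sequences. -/
def coeffDot (p q : ℝ[X]) : ℝ := p.sum fun i a => a * q.coeff i

theorem coeffDot_eq_sum_range {p : ℝ[X]} (q : ℝ[X]) {m : ℕ} (hp : p.natDegree < m) :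
    coeffDot p q = ∑ i ∈ Finset.range m, p.coeff i * q.coeff i :=
  p.sum_over_range' (f := fun i a => a * q.coeff i) (fun _ => zero_mul _) m hp

theorem coeffDot_add_left (p q r : ℝ[X]) : coeffDot (p + q) r = coeffDot p r + coeffDot q r :=
  sum_add_index p q _ (fun _ => zero_mul _) fun _ _ _ => add_mul _ _ _

theorem coeffDot_C_mul_left (a : ℝ) (p q : ℝ[X]) : coeffDot (C a * p) q = a * coeffDot p q := by
  have h : (C a * p).natDegree < p.natDegree + 1 := Nat.lt_succ_of_le (natDegree_C_mul_le a p)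
  rw [coeffDot_eq_sum_range q h, coeffDot_eq_sum_range q p.natDegree.lt_succ_self, Finset.mul_sum]
  simp only [coeff_C_mul, mul_assoc]

theorem coeffDot_comm (p q : ℝ[X]) : coeffDot p q = coeffDot q p := by
  have hp : p.natDegree < p.natDegree + q.natDegree + 1 := by omega
  have hq : q.natDegree < p.natDegree + q.natDegree + 1 := by omega
  rw [coeffDot_eq_sum_range q hp, coeffDot_eq_sum_range p hq]
  simp only [mul_comm]

theorem coeffDot_X_mul (p q : ℝ[X]) : coeffDot (X * p) (X * q) = coeffDot p q := by
  have h : (X * p).natDegree < p.natDegree + 1 + 1 :=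
    Nat.lt_succ_of_le (natDegree_mul_le.trans (by rw [natDegree_X]; omega))
  rw [coeffDot_eq_sum_range _ h, coeffDot_eq_sum_range q p.natDegree.lt_succ_self,
    Finset.sum_range_succ']
  simp

theorem coeffDot_self_nonneg (p : ℝ[X]) : 0 ≤ coeffDot p p :=
  Finset.sum_nonneg fun _ _ => mul_self_nonneg _

theorem coeffDot_self_eq_zero {p : ℝ[X]} (h : coeffDot p p = 0) : p = 0 := by
  by_contra hp
  have h1 := (Finset.sum_eq_zero_iff_of_nonneg fun i _ => mul_self_nonneg (p.coeff i)).mp h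
    p.natDegree (natDegree_mem_support_of_nonzero hp)
  exact hp (leadingCoeff_eq_zero.mp (mul_self_eq_zero.mp h1))

/-- The inner product of the pairs `(p a, p b)` and `(q a, q b)` of coefficient sequences. -/
def pairDot (a b p q : ℝ[X]) : ℝ := coeffDot (p * a) (q * a) + coeffDot (p * b) (q * b)

variable {a b : ℝ[X]}

theorem pairDot_add_left (p q r : ℝ[X]) :
    pairDot a b (p + q) r = pairDot a b p r + pairDot a b q r := by
  simp only [pairDot, add_mul, coeffDot_add_left]
  ring

theorem pairDot_C_mul_left (c : ℝ) (p q : ℝ[X]) :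
    pairDot a b (C c * p) q = c * pairDot a b p q := by
  simp only [pairDot, mul_assoc, coeffDot_C_mul_left]
  ring

theorem pairDot_comm (p q : ℝ[X]) : pairDot a b p q = pairDot a b q p := by
  simp only [pairDot, coeffDot_comm (p * _)]

theorem pairDot_add_right (p q r : ℝ[X]) :
    pairDot a b p (q + r) = pairDot a b p q + pairDot a b p r := by
  simp only [pairDot_comm p, pairDot_add_left]

theorem pairDot_C_mul_right (c : ℝ) (p q : ℝ[X]) :
    pairDot a b p (C c * q) = c * pairDot a b p q := by
  simp only [pairDot_comm p, pairDot_C_mul_left]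

theorem pairDot_X_mul (p q : ℝ[X]) : pairDot a b (X * p) (X * q) = pairDot a b p q := by
  simp only [pairDot, mul_assoc, coeffDot_X_mul]

theorem pairDot_self_nonneg (p : ℝ[X]) : 0 ≤ pairDot a b p p :=
  add_nonneg (coeffDot_self_nonneg _) (coeffDot_self_nonneg _)

theorem pairDot_self_eq_zero (hb : b ≠ 0) {p : ℝ[X]} (h : pairDot a b p p = 0) : p = 0 := by
  have h1 := coeffDot_self_nonneg (p * a)
  have h2 := coeffDot_self_nonneg (p * b)
  rw [pairDot] at h
  exact (mul_eq_zero.mp (coeffDot_self_eq_zero (p := p * b) (by linarith))).resolve_right hb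

/-- `p` is the monic polynomial of degree `m` orthogonal to all polynomials of smaller degree with
respect to `pairDot a b`. Equivalently, `p` minimizes `pairDot a b p p` among the monic polynomials
of degree `m`. -/
structure IsMonicOrthogonal (a b : ℝ[X]) (m : ℕ) (p : ℝ[X]) : Prop where
  monic : p.Monic
  natDegree_eq : p.natDegree = m
  pairDot_eq_zero : ∀ q : ℝ[X], q.degree < m → pairDot a b q p = 0

/-- The difference has degree below m, so it is orthogonal to both polynomials and hence to itself.
-/
theorem IsMonicOrthogonal.unique (hb : b ≠ 0) {m : ℕ} {p q : ℝ[X]}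
    (hp : IsMonicOrthogonal a b m p) (hq : IsMonicOrthogonal a b m q) : p = q := by
  have hd : p.degree = m := by rw [degree_eq_natDegree hp.monic.ne_zero, hp.natDegree_eq]
  have hd' : q.degree = m := by rw [degree_eq_natDegree hq.monic.ne_zero, hq.natDegree_eq]
  have hlt : (p - q).degree < m := by
    rw [← hd]
    exact degree_sub_lt_left (hd.trans hd'.symm) hp.monic.ne_zero
      (hp.monic.leadingCoeff.trans hq.monic.leadingCoeff.symm)
  refine sub_eq_zero.mp (pairDot_self_eq_zero (a := a) hb ?_)
  have h : pairDot a b (p - q) (p + C (-1) * q) = 0 := by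
    rw [pairDot_add_right, pairDot_C_mul_right, hp.pairDot_eq_zero _ hlt,
      hq.pairDot_eq_zero _ hlt, mul_zero, add_zero]
  rwa [C_neg, C_1, neg_one_mul, ← sub_eq_add_neg] at h

/-! ### Roots of the orthogonal polynomials -/

theorem exists_re_im (q : ℂ[X]) : ∃ f g : ℝ[X], q = f.map Complex.ofRealHom +
    C Complex.I * g.map Complex.ofRealHom ∧ f.degree ≤ q.degree ∧ g.degree ≤ q.degree := by
  have key : ∀ φ : ℂ →+ ℝ, ∃ f : ℝ[X], ∀ i, f.coeff i = φ (q.coeff i) := by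
    intro φ
    refine ⟨∑ j ∈ q.support, monomial j (φ (q.coeff j)), fun i => ?_⟩
    by_cases hi : q.coeff i = 0 <;> simp [coeff_monomial, hi]
  have hdeg : ∀ (φ : ℂ →+ ℝ) (f : ℝ[X]), (∀ i, f.coeff i = φ (q.coeff i)) →
      f.degree ≤ q.degree := by
    intro φ f hf
    refine degree_le_iff_coeff_zero _ _ |>.mpr fun i hi => ?_
    rw [hf, coeff_eq_zero_of_degree_lt hi, map_zero]
  obtain ⟨f, hf⟩ := key Complex.reAddGroupHom
  obtain ⟨g, hg⟩ := key Complex.imAddGroupHom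
  refine ⟨f, g, ?_, hdeg _ f hf, hdeg _ g hg⟩
  ext i
  simp only [coeff_add, coeff_map, coeff_C_mul, hf, hg]
  rw [mul_comm]
  exact (Complex.re_add_im _).symm

theorem map_ofReal_add_I_mul_inj {f g f' g' : ℝ[X]}
    (h : f.map Complex.ofRealHom + C Complex.I * g.map Complex.ofRealHom =
      f'.map Complex.ofRealHom + C Complex.I * g'.map Complex.ofRealHom) : f = f' ∧ g = g' := by
  constructor <;> ext i
  · simpa using congrArg (fun p => (coeff p i).re) h
  · simpa using congrArg (fun p => (coeff p i).im) h

/-- If p = (X - z) q, then X q = p + z q with p orthogonal to q. Since X is an isometry, ‖q‖² = ‖p‖²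
+ |z|² ‖q‖² with ‖p‖ > 0, so |z| < 1. The inner product being real, q is split as f + i g. -/
theorem IsMonicOrthogonal.isSchur (hb : b ≠ 0) {m : ℕ} {p : ℝ[X]}
    (hp : IsMonicOrthogonal a b m p) : IsSchur p := by
  intro z hz
  have hroot : (p.map Complex.ofRealHom).IsRoot z := by
    rw [IsRoot, eval_map]
    exact hz
  obtain ⟨q, hq⟩ := dvd_iff_isRoot.mpr hroot
  have hp0 : p.map Complex.ofRealHom ≠ 0 := by
    rw [Ne, Polynomial.map_eq_zero]
    exact hp.monic.ne_zero
  have hq0 : q ≠ 0 := by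
    rintro rfl
    exact hp0 (by rw [hq, mul_zero])
  have hqd : q.degree < m := by
    have h1 := congrArg natDegree hq
    rw [natDegree_mul (X_sub_C_ne_zero z) hq0, natDegree_X_sub_C, natDegree_map,
      hp.natDegree_eq] at h1
    rw [degree_eq_natDegree hq0]
    exact_mod_cast (by omega)
  obtain ⟨f, g, hfg, hf, hg⟩ := exists_re_im q
  -- The equation X q = p + z q, sorted into real and imaginary parts.
  have h1 : (X * f).map Complex.ofRealHom + C Complex.I * (X * g).map Complex.ofRealHom =
      (p + (C z.re * f + C (-z.im) * g)).map Complex.ofRealHom +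
        C Complex.I * (C z.re * g + C z.im * f).map Complex.ofRealHom := by
    have hzC : (C z : ℂ[X]) = C (z.re : ℂ) + C (z.im : ℂ) * C Complex.I := by
      rw [← C_mul, ← C_add, Complex.re_add_im]
    have hI : (C Complex.I : ℂ[X]) * C Complex.I = -1 := by
      rw [← C_mul, Complex.I_mul_I, C_neg, C_1]
    simp only [Polynomial.map_add, Polynomial.map_mul, map_X, map_C, hq, hzC, hfg,
      Polynomial.map_neg,
      Complex.ofRealHom_eq_coe, C_neg]
    linear_combination (C (z.im : ℂ) * g.map Complex.ofRealHom) * hI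
  obtain ⟨h2, h3⟩ := map_ofReal_add_I_mul_inj h1
  have hfp := hp.pairDot_eq_zero f (hf.trans_lt hqd)
  have hgp := hp.pairDot_eq_zero g (hg.trans_lt hqd)
  have hfp' := (pairDot_comm _ _).trans hfp
  have hgp' := (pairDot_comm _ _).trans hgp
  have e1 := pairDot_X_mul (a := a) (b := b) f f
  have e2 := pairDot_X_mul (a := a) (b := b) g g
  rw [h2] at e1
  rw [h3] at e2
  simp only [pairDot_add_left, pairDot_add_right, pairDot_C_mul_left, pairDot_C_mul_right, hfp,
    hgp, hfp', hgp', pairDot_comm g f] at e1 e2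
  have hpos : 0 < pairDot a b p p :=
    lt_of_le_of_ne (pairDot_self_nonneg p) fun h =>
      hp.monic.ne_zero (pairDot_self_eq_zero hb h.symm)
  have hf0 := pairDot_self_nonneg (a := a) (b := b) f
  have hg0 := pairDot_self_nonneg (a := a) (b := b) g
  -- In `e1 + e2` the cross terms ⟨f, g⟩ cancel.
  have hn : z.re * z.re + z.im * z.im < 1 := by
    by_contra! hle
    nlinarith
  have hns : ‖z‖ ^ 2 < 1 := by rwa [← Complex.normSq_eq_norm_sq, Complex.normSq_apply]
  exact (sq_lt_one_iff₀ (norm_nonneg z)).mp hns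

/-! ### The left kernel of the data matrix -/

variable {N L T : ℕ}

/-- The row vector, indexed as the rows of `Hinv`, of the relation
`(h a)_N u_N = ∑ (h b)_k y_k - ∑_{k < N} (h a)_k u_k`. -/
def relationVec (a b : ℝ[X]) (N L : ℕ) : ℝ[X] →ₗ[ℝ] (Fin N ⊕ (Fin N ⊕ Fin (L + 1)) → ℝ) where
  toFun h := Sum.elim (fun i => -(h * a).coeff i)
    (Sum.elim (fun i => (h * b).coeff i) fun i => (h * b).coeff (N + i))
  map_add' p q := by
    funext i
    rcases i with i | i | i <;> simp [add_mul]
    ring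
  map_smul' r p := by
    funext i
    rcases i with i | i | i <;> simp

theorem sum_append_range {f g : ℕ → ℝ} {L : ℕ} :
    ∑ i : Fin N, f i * g i + ∑ i : Fin (L + 1), f (N + i) * g (N + i) =
      ∑ t ∈ Finset.range (N + 1 + L), f t * g t := by
  rw [show N + 1 + L = N + (L + 1) by omega, Finset.sum_range_add, Finset.sum_range,
    Finset.sum_range]

/-- The row vector drops the coefficients of `q * a` from degree N on; they would meet only zero
coefficients of `p * a`. -/
theorem relationVec_dotProduct (a b p q : ℝ[X]) (hp : (p * b).natDegree ≤ N + L)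
    (hpa : (p * a).natDegree < N) :
    relationVec a b N L p ⬝ᵥ relationVec a b N L q = pairDot a b p q := by
  rw [pairDot, coeffDot_eq_sum_range _ hpa, coeffDot_eq_sum_range (m := N + 1 + L) _ (by omega),
    ← sum_append_range, Finset.sum_range]
  simp [relationVec, dotProduct]

theorem relationVec_vecMul_Hinv {k : ℕ} {S : SISO k} (hS : S.ObservablePartReachable)
    {Up : Matrix (Fin N) (Fin T) ℝ} {Uf : Fin T → ℝ} {Yp : Matrix (Fin N) (Fin T) ℝ}
    {Yf : Matrix (Fin (L + 1)) (Fin T) ℝ} (hdata : IsData S Up Uf Yp Yf) {h : ℝ[X]}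
    (ha : (h * S.transfer.num).natDegree ≤ N) (hb : (h * S.transfer.denom).natDegree ≤ N + L) :
    relationVec S.transfer.num S.transfer.denom N L h ᵥ* Hinv Up Yp Yf =
      (h * S.transfer.num).coeff N • Uf := by
  funext j
  obtain ⟨u', x, hx⟩ := hdata j
  set u0 : Fin (N + 1 + L) → ℝ :=
    Fin.append (Fin.snoc (fun i => Up i j) (Uf j) : Fin (N + 1) → ℝ) u' with hu0
  set y0 : Fin (N + 1 + L) → ℝ := fun i => Fin.append (fun i => Yp i j) (fun i => Yf i j)
    (Fin.cast (show N + 1 + L = N + (L + 1) by omega) i) with hy0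
  let u : ℕ → ℝ := fun t => if ht : t < N + 1 + L then u0 ⟨t, ht⟩ else 0
  let y : ℕ → ℝ := fun t => if ht : t < N + 1 + L then y0 ⟨t, ht⟩ else 0
  have hmul : algebraMap ℝ[X] (RatFunc ℝ) (h * S.transfer.denom) * S.transfer =
      algebraMap ℝ[X] (RatFunc ℝ) (h * S.transfer.num) := by
    have hden : algebraMap ℝ[X] (RatFunc ℝ) S.transfer.denom ≠ 0 :=
      (map_ne_zero_iff _ (RatFunc.algebraMap_injective ℝ)).mpr S.transfer.denom_ne_zero
    have hnum := (div_eq_iff hden).mp S.transfer.num_div_denom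
    rw [map_mul, map_mul, hnum, mul_assoc, mul_comm S.transfer]
  -- Only N + 1 inputs are summed because deg(h a) ≤ N, so the unknown prolongation `u'` does not
  -- enter.
  have key := S.sum_output_eq_sum_input hS hmul (x := x) (u := u) (y := y) (q := N + 1 + L)
    (r := N + 1) (fun t ht => by simpa [u, ht] using (hx ⟨t, ht⟩).1)
    (fun t ht => by simpa [u, y, ht] using (hx ⟨t, ht⟩).2) (by omega) (by omega)
  have hu : ∀ i : Fin N, u i = Up i j := by
    intro i
    have : (i : ℕ) < N + 1 + L := by omega
    simp [u, this, hu0, Fin.append, Fin.addCases, Fin.snoc]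
  have huN : u N = Uf j := by
    simp [u, hu0, Fin.append, Fin.addCases, Fin.snoc, show N < N + 1 + L by omega]
  have hyp : ∀ i : Fin N, y i = Yp i j := by
    intro i
    have : (i : ℕ) < N + 1 + L := by omega
    simp [y, this, hy0, Fin.append, Fin.addCases]
  have hyf : ∀ i : Fin (L + 1), y (N + i) = Yf i j := by
    intro i
    have : N + (i : ℕ) < N + 1 + L := by omega
    simp [y, this, hy0, Fin.append, Fin.addCases]
  rw [← sum_append_range, Finset.sum_range_succ, Finset.sum_range] at key
  simp only [hu, huN, hyp, hyf] at key
  simp only [relationVec, Hinv, vecMul, dotProduct, LinearMap.coe_mk, AddHom.coe_mk,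
    Fintype.sum_sum_type, Sum.elim_inl, Sum.elim_inr, fromRows_apply_inl, fromRows_apply_inr,
    Pi.smul_apply, smul_eq_mul, neg_mul, Finset.sum_neg_distrib]
  linarith

theorem finrank_ker_vecMulLinear {m n : Type*} [Fintype m] [Fintype n] (A : Matrix m n ℝ) :
    Module.finrank ℝ (LinearMap.ker A.vecMulLinear) + A.rank = Fintype.card m := by
  have h := LinearMap.finrank_range_add_finrank_ker A.vecMulLinear
  have h2 : Module.finrank ℝ (LinearMap.range A.vecMulLinear) = A.rank := by
    have hA : Aᵀ.mulVecLin = A.vecMulLinear := LinearMap.ext fun v => mulVec_transpose A v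
    rw [← rank_transpose, Matrix.rank, hA]
  rw [h2, Module.finrank_pi] at h
  omega

/-- The output entries alone contain every coefficient of `h * b`. -/
theorem relationVec_injOn {a b : ℝ[X]} (hb : b ≠ 0) {h : ℝ[X]} (hd : (h * b).natDegree ≤ N + L)
    (h0 : relationVec a b N L h = 0) : h = 0 := by
  refine (mul_eq_zero.mp ?_).resolve_right hb
  ext i
  rw [coeff_zero]
  by_cases h1 : i < N
  · exact congrFun h0 (Sum.inr (Sum.inl ⟨i, h1⟩))
  by_cases h2 : i ≤ N + L
  · have := congrFun h0 (Sum.inr (Sum.inr ⟨i - N, by omega⟩))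
    simpa [relationVec, show N + (i - N) = i by omega] using this
  · exact coeff_eq_zero_of_natDegree_lt (by omega)

theorem natDegree_mul_le_of_degree_lt {q p : ℝ[X]} {m : ℕ} (hq : q.degree < m) :
    (q * p).natDegree + 1 ≤ m + p.natDegree ∨ q = 0 := by
  by_cases h : q = 0
  · exact .inr h
  · rw [degree_eq_natDegree h] at hq
    have : q.natDegree < m := by exact_mod_cast hq
    have := natDegree_mul_le (p := q) (q := p)
    exact .inl (by omega)

/-- If the relations of degree less than `m` annihilate `H` and `H` has the complementary rank,
then they form the left kernel of `H`. -/
theorem exists_relationVec_of_vecMul_eq_zero {a b : ℝ[X]} (hb : b ≠ 0) {m : ℕ}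
    (hm : m + b.natDegree ≤ N + L) {H : Matrix (Fin N ⊕ (Fin N ⊕ Fin (L + 1))) (Fin T) ℝ}
    (hH : ∀ q : ℝ[X], q.degree < m → relationVec a b N L q ᵥ* H = 0)
    (hrank : H.rank + m = 2 * N + L + 1) {w : Fin N ⊕ (Fin N ⊕ Fin (L + 1)) → ℝ}
    (hw : w ᵥ* H = 0) : ∃ q : ℝ[X], q.degree < m ∧ relationVec a b N L q = w := by
  have hle : (degreeLT ℝ m).map (relationVec a b N L) ≤ LinearMap.ker H.vecMulLinear := by
    rintro _ ⟨q, hq, rfl⟩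
    exact hH q (mem_degreeLT.mp hq)
  have hinj : Function.Injective ((relationVec a b N L).domRestrict (degreeLT ℝ m)) := by
    rw [injective_iff_map_eq_zero]
    rintro ⟨q, hq⟩ h0
    rw [Submodule.mk_eq_zero]
    rcases natDegree_mul_le_of_degree_lt (p := b) (mem_degreeLT.mp hq) with h | h
    · exact relationVec_injOn hb (by omega) h0
    · exact h
  have hfin : Module.finrank ℝ ((degreeLT ℝ m).map (relationVec a b N L)) = m := by
    rw [← LinearMap.range_domRestrict, LinearMap.finrank_range_of_inj hinj,
      (degreeLTEquiv ℝ m).finrank_eq, Module.finrank_pi, Fintype.card_fin]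
  have hker := finrank_ker_vecMulLinear H
  simp only [Fintype.card_sum, Fintype.card_fin] at hker
  -- There are 2N + L + 1 rows, so the left kernel also has dimension m.
  have heq := Submodule.eq_of_le_of_finrank_eq hle (by omega)
  have hmem : w ∈ LinearMap.ker H.vecMulLinear := hw
  rw [← heq] at hmem
  obtain ⟨q, hq, rfl⟩ := hmem
  exact ⟨q, mem_degreeLT.mp hq, rfl⟩

/-! ### The minimum-norm solution -/

theorem vecMul_pinv_mul_eq {m n : Type*} [Fintype m] [Fintype n] [DecidableEq n]
    {A : Matrix m n ℝ} {v : n → ℝ} {w : m → ℝ} (h : w ᵥ* A = v) :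
    (v ᵥ* pinv A) ᵥ* A = v := by
  rw [← h, vecMul_vecMul, vecMul_vecMul, ← Matrix.mul_assoc, (isMoorePenrose_pinv A).mul_mul_left]

/-- Since A† = A† (A A†) and A A† is symmetric, v A† lies in the column space of A, which the left
kernel annihilates. -/
theorem dotProduct_vecMul_pinv_eq_zero {m n : Type*} [Fintype m] [Fintype n] [DecidableEq n]
    {A : Matrix m n ℝ} (v : n → ℝ) {w : m → ℝ} (h : w ᵥ* A = 0) : w ⬝ᵥ (v ᵥ* pinv A) = 0 := by
  have hA := isMoorePenrose_pinv A
  rw [← hA.mul_mul_right, Matrix.mul_assoc, ← vecMul_vecMul, ← hA.symm_left, vecMul_transpose,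
    dotProduct_mulVec, ← vecMul_vecMul, h, zero_vecMul, zero_dotProduct]

theorem Ninv_eq_of_coeffs_eq {a b h : ℝ[X]} {Up : Matrix (Fin N) (Fin T) ℝ} {Uf : Fin T → ℝ}
    {Yp : Matrix (Fin N) (Fin T) ℝ} {Yf : Matrix (Fin (L + 1)) (Fin T) ℝ}
    (hc : coeffs Up Uf Yp Yf = relationVec a b N L h) (hd : (h * a).natDegree ≤ N)
    (h1 : (h * a).coeff N = 1) : Ninv Up Uf Yp Yf = h * a := by
  rw [Ninv, (h * a).as_sum_range_C_mul_X_pow' (n := N + 1) (by omega), Finset.sum_range_succ, h1,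
    C_1, one_mul, Finset.sum_range, hc, add_comm (∑ i : Fin N, _), sub_eq_add_neg, ← Finset.sum_neg_distrib]
  simp [relationVec]

theorem Dinv_eq_of_coeffs_eq {a b h : ℝ[X]} {Up : Matrix (Fin N) (Fin T) ℝ} {Uf : Fin T → ℝ}
    {Yp : Matrix (Fin N) (Fin T) ℝ} {Yf : Matrix (Fin (L + 1)) (Fin T) ℝ}
    (hc : coeffs Up Uf Yp Yf = relationVec a b N L h) (hd : (h * b).natDegree ≤ N + L) :
    Dinv Up Uf Yp Yf = h * b := by
  rw [Dinv, (h * b).as_sum_range_C_mul_X_pow' (n := N + (L + 1)) (by omega),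
    Finset.sum_range_add, Finset.sum_range, Finset.sum_range, hc]
  rfl

/-- The data-driven inverse is `(C N / ρ, C D / ρ)` with `C` the monic orthogonal polynomial of
degree `N + ν - n` for the pair `(N, D)`. -/
theorem exists_isMonicOrthogonal {k : ℕ} {S : SISO k} (h0 : S.transfer ≠ 0)
    (hS : S.ObservablePartReachable) (hL : relDegree S.transfer ≤ L)
    {Up : Matrix (Fin N) (Fin T) ℝ} {Uf : Fin T → ℝ} {Yp : Matrix (Fin N) (Fin T) ℝ}
    {Yf : Matrix (Fin (L + 1)) (Fin T) ℝ} (hdata : IsData S Up Uf Yp Yf)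
    (hrank : (Hinv Up Yp Yf).rank =
      N + order S.transfer + (L - relDegree S.transfer) + 1) :
    order S.transfer ≤ N + relDegree S.transfer ∧
    ∃ p : ℝ[X], IsMonicOrthogonal S.transfer.num S.transfer.denom
        (N + relDegree S.transfer - order S.transfer) p ∧
      Ninv Up Uf Yp Yf = C (1 / S.transfer.num.leadingCoeff) * p * S.transfer.num ∧
      Dinv Up Uf Yp Yf = C (1 / S.transfer.num.leadingCoeff) * p * S.transfer.denom := by
  have hprop := S.transfer_proper
  have hdata' := fun h => relationVec_vecMul_Hinv hS hdata (h := h)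
  have hb := S.transfer.denom_ne_zero
  have ha := RatFunc.num_ne_zero h0
  have hcard := (Hinv Up Yp Yf).rank_le_card_height
  simp only [Fintype.card_sum, Fintype.card_fin] at hcard
  simp only [order, relDegree] at *
  generalize S.transfer.num = a at *
  generalize S.transfer.denom = b at *
  -- The rank cannot exceed the number of rows, hence n ≤ N + ν and the subtraction defining `m` is
  -- not truncated.
  have hle : b.natDegree ≤ N + (b.natDegree - a.natDegree) := by omega
  refine ⟨hle, ?_⟩
  obtain ⟨m, hm⟩ : ∃ m, m = N + (b.natDegree - a.natDegree) - b.natDegree := ⟨_, rfl⟩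
  rw [← hm]
  have hρ : a.leadingCoeff ≠ 0 := leadingCoeff_ne_zero.mpr ha
  have hlow : ∀ q : ℝ[X], q.degree < m → relationVec a b N L q ᵥ* Hinv Up Yp Yf = 0 := by
    intro q hq
    rcases natDegree_mul_le_of_degree_lt (p := a) hq with h | rfl
    · rcases natDegree_mul_le_of_degree_lt (p := b) hq with h' | rfl
      · rw [hdata' q (by omega) (by omega), coeff_eq_zero_of_natDegree_lt (by omega), zero_smul]
      · simp
    · simp
  have hmonic : ∀ p : ℝ[X], p.Monic → p.natDegree = m →
      relationVec a b N L (C (1 / a.leadingCoeff) * p) ᵥ* Hinv Up Yp Yf = Uf ∧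
      (C (1 / a.leadingCoeff) * p * a).natDegree ≤ N ∧
      (C (1 / a.leadingCoeff) * p * a).coeff N = 1 ∧
      (C (1 / a.leadingCoeff) * p * b).natDegree ≤ N + L := by
    intro p hp hpm
    have h1 : (C (1 / a.leadingCoeff) * p * a).natDegree ≤ N := by
      rw [mul_assoc]
      refine (natDegree_C_mul_le _ _).trans (natDegree_mul_le.trans ?_)
      omega
    have h2 : (C (1 / a.leadingCoeff) * p * b).natDegree ≤ N + L := by
      rw [mul_assoc]
      refine (natDegree_C_mul_le _ _).trans (natDegree_mul_le.trans ?_)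
      omega
    have h3 : (C (1 / a.leadingCoeff) * p * a).coeff N = 1 := by
      rw [mul_assoc, coeff_C_mul, show N = p.natDegree + a.natDegree by omega,
        coeff_mul_degree_add_degree, hp.leadingCoeff, one_mul, one_div_mul_cancel hρ]
    exact ⟨by rw [hdata' _ h1 h2, h3, one_smul], h1, h3, h2⟩
  -- X^m serves as one particular solution; `coeffs` differs from it by a kernel vector, that is, by
  -- a relation `q` of degree below m.
  obtain ⟨hX, -, -, -⟩ := hmonic (X ^ m) (monic_X_pow m) (natDegree_X_pow m)
  have hw : coeffs Up Uf Yp Yf ᵥ* Hinv Up Yp Yf = Uf := vecMul_pinv_mul_eq hX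
  obtain ⟨q, hq, hqw⟩ := exists_relationVec_of_vecMul_eq_zero (a := a) (H := Hinv Up Yp Yf)
    (w := coeffs Up Uf Yp Yf - relationVec a b N L (C (1 / a.leadingCoeff) * X ^ m)) hb
    (m := m) (by omega) hlow (by omega) (by rw [sub_vecMul, hw, hX, sub_self])
  have hq' : (C a.leadingCoeff * q).degree < m := by rwa [degree_C_mul hρ]
  -- The factor ρ on `q` cancels the normalization 1/ρ and keeps p monic.
  obtain ⟨p, hp⟩ : ∃ p, p = X ^ m + C a.leadingCoeff * q := ⟨_, rfl⟩
  have hpm : p.Monic := hp ▸ monic_X_pow_add hq'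
  have hpd : p.natDegree = m := by
    rw [hp]
    exact natDegree_eq_of_degree_eq_some
      ((degree_add_eq_left_of_degree_lt (by rwa [degree_X_pow])).trans (degree_X_pow m))
  have hc : coeffs Up Uf Yp Yf = relationVec a b N L (C (1 / a.leadingCoeff) * p) := by
    rw [eq_add_of_sub_eq hqw.symm, ← map_add, hp, mul_add, ← mul_assoc _ (C a.leadingCoeff),
      ← C_mul, one_div_mul_cancel hρ, C_1, one_mul, add_comm q]
  obtain ⟨-, h1, h2, h3⟩ := hmonic p hpm hpd
  refine ⟨p, ⟨hpm, hpd, fun r hr => ?_⟩, Ninv_eq_of_coeffs_eq hc h1 h2,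
    Dinv_eq_of_coeffs_eq hc h3⟩
  have h4 : relationVec a b N L r ⬝ᵥ coeffs Up Uf Yp Yf = 0 :=
    dotProduct_vecMul_pinv_eq_zero Uf (hlow r hr)
  rcases natDegree_mul_le_of_degree_lt (p := a) hr with h | rfl
  · rcases natDegree_mul_le_of_degree_lt (p := b) hr with h' | rfl
    · rw [hc, relationVec_dotProduct _ _ _ _ (by omega) (by omega), pairDot_C_mul_right] at h4
      exact (mul_eq_zero.mp h4).resolve_left (one_div_ne_zero hρ)
    · simp [pairDot, coeffDot]
  · simp [pairDot, coeffDot]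

end DDInv

end

theorem theorem4 :
    ∃ Cinv : RatFunc ℝ → ℕ → ℝ[X],
      ∀ (k : ℕ) (S : DDInv.SISO k) (G : RatFunc ℝ), S.transfer = G → G ≠ 0 →
        S.ObservablePartReachable →
      ∀ (N L T : ℕ), S.lag ≤ N → DDInv.relDegree G ≤ L →
      ∀ (Up : Matrix (Fin N) (Fin T) ℝ) (Uf : Fin T → ℝ) (Yp : Matrix (Fin N) (Fin T) ℝ)
        (Yf : Matrix (Fin (L + 1)) (Fin T) ℝ),
        DDInv.IsData S Up Uf Yp Yf →
        (DDInv.Hinv Up Yp Yf).rank = N + DDInv.order G + (L - DDInv.relDegree G) + 1 →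
        (Cinv G N).Monic ∧
        (Cinv G N).natDegree + DDInv.order G = N + DDInv.relDegree G ∧
        DDInv.IsSchur (Cinv G N) ∧
        DDInv.Ninv Up Uf Yp Yf = C (1 / G.num.leadingCoeff) * Cinv G N * G.num ∧
        DDInv.Dinv Up Uf Yp Yf = C (1 / G.num.leadingCoeff) * Cinv G N * G.denom := by
  classical
  let Q : RatFunc ℝ → ℕ → ℝ[X] → Prop := fun G N =>
    DDInv.IsMonicOrthogonal G.num G.denom (N + DDInv.relDegree G - DDInv.order G)
  -- The polynomial is chosen from a predicate in G and N only, which gives independence of L, the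
  -- data and the realization. Under the hypotheses the default 0 is never taken, and uniqueness
  -- identifies the choice with the p found from the data.
  refine ⟨fun G N => if h : ∃ p, Q G N p then h.choose else 0, ?_⟩
  rintro k S G rfl h0 hS N L T - hL Up Uf Yp Yf hdata hrank
  obtain ⟨hle, p, hp, hN, hD⟩ := DDInv.exists_isMonicOrthogonal h0 hS hL hdata hrank
  have hex : ∃ p, Q S.transfer N p := ⟨p, hp⟩
  have heq : hex.choose = p :=
    DDInv.IsMonicOrthogonal.unique S.transfer.denom_ne_zero hex.choose_spec hp
  simp only [dif_pos hex, heq]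
  exact ⟨hp.monic, by rw [hp.natDegree_eq]; omega, hp.isSchur S.transfer.denom_ne_zero, hN, hD⟩
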